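/- Let $n\ge 2$, $m\in\{1,\dots,n-1\}$ and $p\in\mathbb R$. Let $P$ and $P'$ be polytopes in $\mathbb R^n$ (convex hulls of finitely many points, of positive volume) which contain the origin in their interiors. For a compact convex set $K\subset\mathbb R^n$ containing the origin in its interior, let $\rho_K(u)=\max\{t\ge 0: tu\in K\}$ for $u\in S^{n-1}$; for $x\in\partial K$ let $N(K,x)=\{y: y\cdot(z-x)\le 0 \text{ for all } z\in K\}$ be the normal cone, and let $\nu_K(x)\in N(K,x)\cap S^{n-1}$ be an exterior unit normal of $K$ at $x$ (unique for $\mathcal H^{n-1}$-almost every $x\in\partial K$, chosen arbitrarily at the other points). For a Borel set $\eta\subset S^{n-1}$ let $$\boldsymbol\alpha_K^*(\eta)=\{u\in S^{n-1}: N(K,\rho_K(u)u)\cap\eta\neq\emptyset\}.$$ Let $\omega_k$ be the volume of the unit ball of $\mathbb R^k$. For a nonnegative function $F$ of the $m$-dimensional linear subspaces of $\mathbb R^n$ and $u\in S^{n-1}$ let $$\mathcal R_m^*F(u)=\frac{m\,\omega_m}{n\,\omega_n}\int F(\operatorname{span}\{u,\zeta\})\,d\nu_{m-1}(\zeta),$$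 where $\nu_{m-1}$ is the rotation invariant probability measure on the Grassmannian of $(m-1)$-dimensional linear subspaces $\zeta$ of $u^\perp$. The $L_p$ curvature measure $\widetilde C^a_{p,m}(K,\cdot)$ of affine dual quermassintegrals is defined for Borel sets $\eta\subset S^{n-1}$ by $$\widetilde C^a_{p,m}(K,\eta)=\int_{\boldsymbol\alpha_K^*(\eta)}\bigl(u\cdot\nu_K(\rho_K(u)u)\bigr)^{-p}\,\rho_K(u)^{m-p}\,\mathcal R_m^*\bigl(\operatorname{vol}_m(K\cap\cdot)^{n-1}\bigr)(u)\,du,$$ where $du$ is the spherical Lebesgue measure. Suppose that $\widetilde C^a_{p,m}(P,\eta)=\widetilde C^a_{p,m}(P',\eta)$ for every Borel set $\eta\subset S^{n-1}$. Then: 1. if $p>mn$, then $P=P'$; 2. if $p=mn$, then $P'$ is a dilate of $P$, that is, $P'=\lambda P$ for some $\lambda>0$. -/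

import Mathlib

open MeasureTheory
open scoped ENNReal Pointwise

namespace ADQ

/-! ### The Grassmannian and its Haar probability measure -/

section Grassmannian

variable (V : Type*) [NormedAddCommGroup V] [InnerProductSpace ℝ V] [FiniteDimensional ℝ V]
  [CompleteSpace V]

/-- The Grassmannian of `k`-dimensional linear subspaces of `V`. -/
def Grassmannian (k : ℕ) : Type _ := {ζ : Submodule ℝ V // Module.finrank ℝ ζ = k}

/-- The usual topology: subspaces are identified with their orthogonal projections. -/
noncomputable instance (k : ℕ) : TopologicalSpace (Grassmannian V k) :=
  TopologicalSpace.induced (fun ζ => (ζ.1.starProjection : V →L[ℝ] V)) inferInstance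

noncomputable instance (k : ℕ) : MeasurableSpace (Grassmannian V k) := borel _

instance (k : ℕ) : BorelSpace (Grassmannian V k) := ⟨rfl⟩

/-- The orthogonal group of `V`, with the topology of the operator norm. -/
abbrev OrthogonalGroup : Type _ := unitary (V →L[ℝ] V)

instance : CompactSpace (OrthogonalGroup V) := by
  have : ProperSpace (V →L[ℝ] V) := FiniteDimensional.proper ℝ _
  refine isCompact_iff_compactSpace.mp
    (Metric.isCompact_of_isClosed_isBounded (isClosed_unitary (R := V →L[ℝ] V)) ?_)
  refine (Metric.isBounded_closedBall (x := (0 : V →L[ℝ] V)) (r := 1)).subset ?_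
  intro g hg
  rw [mem_closedBall_zero_iff]
  refine g.opNorm_le_bound zero_le_one fun x => ?_
  rw [one_mul]
  exact ((Unitary.linearIsometryEquiv (⟨g, hg⟩ : unitary (V →L[ℝ] V))).norm_map x).le

variable {V}

/-- The image of a `k`-dimensional subspace under an orthogonal transformation. -/
noncomputable def Grassmannian.rotate {k : ℕ} (g : OrthogonalGroup V) (ζ : Grassmannian V k) :
    Grassmannian V k :=
  ⟨ζ.1.map (Unitary.linearIsometryEquiv g).toLinearEquiv.toLinearMap, by
    rw [LinearEquiv.finrank_map_eq, ζ.2]⟩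

theorem Grassmannian.starProjection_rotate {k : ℕ} (g : OrthogonalGroup V)
    (ζ : Grassmannian V k) :
    (Grassmannian.rotate g ζ).1.starProjection =
      (g : V →L[ℝ] V) * ζ.1.starProjection * star (g : V →L[ℝ] V) := by
  ext x
  have h := Submodule.starProjection_map_apply (Unitary.linearIsometryEquiv g) ζ.1 x
  have h2 : (Unitary.linearIsometryEquiv g).symm x = (star (g : V →L[ℝ] V)) x := rfl
  rw [h2] at h
  exact h

theorem Grassmannian.continuous_rotate {k : ℕ} (ζ : Grassmannian V k) :
    Continuous (fun g : OrthogonalGroup V => Grassmannian.rotate g ζ) := by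
  refine continuous_induced_rng.2 ?_
  have : ((fun ζ : Grassmannian V k => (ζ.1.starProjection : V →L[ℝ] V)) ∘
      fun g : OrthogonalGroup V => Grassmannian.rotate g ζ) =
      fun g : OrthogonalGroup V => (g : V →L[ℝ] V) * ζ.1.starProjection * star (g : V →L[ℝ] V) :=
    funext fun g => Grassmannian.starProjection_rotate g ζ
  rw [this]
  fun_prop

variable (V)

/-- The Haar probability measure of the orthogonal group of `V`. -/
noncomputable def orthogonalHaar : Measure (OrthogonalGroup V) := Measure.haarMeasure ⊤

open Classical in
/-- The Haar probability measure (the unique rotation invariant Borel probability measure) of the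
Grassmannian of `k`-dimensional subspaces of `V`: the image of the Haar probability measure of the
orthogonal group under `g ↦ g ζ₀`, where `ζ₀` is any fixed `k`-dimensional subspace. It is only
used for `k ≤ dim V`, where such a `ζ₀` exists. -/
noncomputable def grassmannianHaar (k : ℕ) : Measure (Grassmannian V k) :=
  if h : Nonempty (Grassmannian V k) then
    (orthogonalHaar V).map (fun g => Grassmannian.rotate g (Classical.choice h))
  else 0

instance : IsProbabilityMeasure (orthogonalHaar V) :=
  ⟨Measure.haarMeasure_self
    (K₀ := (⊤ : TopologicalSpace.PositiveCompacts (OrthogonalGroup V)))⟩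

theorem Grassmannian.nonempty {k : ℕ} (hk : k ≤ Module.finrank ℝ V) :
    Nonempty (Grassmannian V k) := by
  obtain ⟨f, hf⟩ := exists_linearIndependent_of_le_finrank hk
  exact ⟨Submodule.span ℝ (Set.range f), by simpa using finrank_span_eq_card hf⟩

/-- `grassmannianHaar` is a probability measure. -/
theorem grassmannianHaar_isProbabilityMeasure {k : ℕ} (hk : k ≤ Module.finrank ℝ V) :
    IsProbabilityMeasure (grassmannianHaar V k) := by
  rw [grassmannianHaar, dif_pos (Grassmannian.nonempty V hk)]
  exact Measure.isProbabilityMeasure_map (Grassmannian.continuous_rotate _).measurable.aemeasurable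

/-- `grassmannianHaar` is invariant under rotations. -/
theorem grassmannianHaar_map_rotate {k : ℕ} (g : OrthogonalGroup V) :
    (grassmannianHaar V k).map (Grassmannian.rotate g) = grassmannianHaar V k := by
  by_cases h : Nonempty (Grassmannian V k)
  · have hcont : Continuous (Grassmannian.rotate (V := V) (k := k) g) := by
      refine continuous_induced_rng.2 ?_
      have : ((fun ζ : Grassmannian V k => (ζ.1.starProjection : V →L[ℝ] V)) ∘
          Grassmannian.rotate g) =
          fun ζ => (g : V →L[ℝ] V) * ζ.1.starProjection * star (g : V →L[ℝ] V) :=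
        funext fun ζ => Grassmannian.starProjection_rotate g ζ
      rw [this]
      have h1 : Continuous fun ζ : Grassmannian V k => (ζ.1.starProjection : V →L[ℝ] V) :=
        continuous_induced_dom
      fun_prop
    have hmul : ∀ (a b : OrthogonalGroup V) (ζ : Grassmannian V k),
        Grassmannian.rotate a (Grassmannian.rotate b ζ) = Grassmannian.rotate (a * b) ζ := by
      intro a b ζ
      refine Subtype.ext ?_
      change (Submodule.map _ (Submodule.map _ _)) = Submodule.map _ _
      rw [← Submodule.map_comp]
      rfl
    have hr := (Grassmannian.continuous_rotate (Classical.choice h)).measurable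
    rw [grassmannianHaar, dif_pos h, Measure.map_map hcont.measurable hr]
    have hinv : (orthogonalHaar V).map (fun a => g * a) = orthogonalHaar V := by
      unfold orthogonalHaar
      exact map_mul_left_eq_self _ g
    conv_rhs => rw [← hinv, Measure.map_map hr (measurable_const_mul g)]
    congr 1
    funext a
    exact hmul g a _
  · simp [grassmannianHaar, h]

end Grassmannian

/-! ### Convex bodies -/

/-- Euclidean `n`-space. -/
abbrev E (n : ℕ) : Type := EuclideanSpace ℝ (Fin n)

/-- The unit sphere of `ℝⁿ`. -/
abbrev S (n : ℕ) : Type := Metric.sphere (0 : E n) 1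

/-- The spherical Lebesgue measure `𝓗ⁿ⁻¹` on the unit sphere. -/
noncomputable def sphereMeasure (n : ℕ) : Measure (S n) := (volume : Measure (E n)).toSphere

/-- The volume of the unit ball of `ℝⁿ`. -/
noncomputable def ballVolume (n : ℕ) : ℝ≥0∞ := volume (Metric.ball (0 : E n) 1)

variable {n : ℕ}

/-- A polytope is the convex hull of a finite set of points, of positive volume. -/
def IsPolytope (P : Set (E n)) : Prop :=
  (∃ s : Set (E n), s.Finite ∧ P = convexHull ℝ s) ∧ 0 < volume P

/-- The radial function `ρ_K(x) = max {t ≥ 0 : t x ∈ K}`. -/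
noncomputable def radial (K : Set (E n)) (x : E n) : ℝ := sSup {t : ℝ | 0 ≤ t ∧ t • x ∈ K}

/-- The normal cone `N(K, z)`. -/
def normalCone (K : Set (E n)) (z : E n) : Set (E n) :=
  {y | ∀ x ∈ K, inner ℝ y (x - z) ≤ 0}

/-- The Gauss image of `K` at `z`: the exterior unit normals of `K` at `z`. -/
def gaussImage (K : Set (E n)) (z : E n) : Set (S n) := {v | (v : E n) ∈ normalCone K z}

/-- The reverse Gauss image of `η`: the boundary points having an exterior unit normal in `η`. -/
def reverseGaussImage (K : Set (E n)) (η : Set (S n)) : Set (E n) :=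
  {z | z ∈ frontier K ∧ (gaussImage K z ∩ η).Nonempty}

/-- The reverse radial Gauss image of `η`: the directions `u` such that `ρ_K(u) u` lies in the
reverse Gauss image of `η`. -/
def reverseRadialGaussImage (K : Set (E n)) (η : Set (S n)) : Set (S n) :=
  {u | radial K (u : E n) • (u : E n) ∈ reverseGaussImage K η}

open Classical in
/-- An exterior unit normal of `K` at `z`. It is unique at `𝓗ⁿ⁻¹`-almost every boundary
point `z`, and an arbitrary choice among the exterior unit normals at the other ones. -/
noncomputable def outerNormal (K : Set (E n)) (z : E n) : E n :=
  if h : (gaussImage K z).Nonempty then (h.some : E n) else 0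

/-! ### Dual Radon transform and curvature measures -/

/-- `span {u, ζ}`, for a subspace `ζ` of the orthogonal complement of `u`. -/
noncomputable def spanWith (u : E n) (ζ : Submodule ℝ (ℝ ∙ u)ᗮ) : Submodule ℝ (E n) :=
  (ℝ ∙ u) ⊔ ζ.map (ℝ ∙ u)ᗮ.subtype

/-- The `m`-dimensional dual Radon transform of a nonnegative function `F` of the `m`-dimensional
subspaces (no other value of `F` matters): `(m ω_m) / (n ω_n)` times the mean of
`F (span {u, ζ})` over the `(m - 1)`-dimensional subspaces `ζ` of the orthogonal complement
of `u`. -/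
noncomputable def dualRadon (m : ℕ) (F : Submodule ℝ (E n) → ℝ≥0∞) (u : S n) : ℝ≥0∞ :=
  (m * ballVolume m) / (n * ballVolume n) *
    ∫⁻ ζ, F (spanWith (u : E n) ζ.1) ∂(grassmannianHaar (ℝ ∙ (u : E n))ᗮ (m - 1))

/-- The volume of `K ∩ ξ`, as a subset of the Euclidean space `ξ`. -/
noncomputable def sectionVolume (K : Set (E n)) (ξ : Submodule ℝ (E n)) : ℝ≥0∞ :=
  (volume : Measure ξ) {x | (x : E n) ∈ K}

/-- The `L_p` curvature measure of affine dual quermassintegrals of a convex body `K` containing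
the origin in its interior, evaluated at a Borel set `η`. -/
noncomputable def curvatureMeasure (p : ℝ) (m : ℕ) (K : Set (E n)) (η : Set (S n)) : ℝ≥0∞ :=
  ∫⁻ u in reverseRadialGaussImage K η,
    ENNReal.ofReal
      ((inner ℝ (u : E n) (outerNormal K (radial K (u : E n) • (u : E n)))) ^ (-p) *
        radial K (u : E n) ^ ((m : ℝ) - p)) *
      dualRadon m (fun ξ => sectionVolume K ξ ^ (n - 1)) u ∂(sphereMeasure n)

end ADQ

namespace ADQ

/-! ### Convex bodies with the origin in the interior -/

section Body

open Set Topology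

variable {n : ℕ}

/-! Only the point masses at unit vectors v matter. On the cone over the face with normal v, u · v =
h(v) / ρ(u), so the integrand becomes h(v)^(-p) times ρ(u)^m times the dual Radon transform. Hence
the mass at v is h(v)^(-p) times an integral over the face cone (`curvatureMeasure_singleton`). That
integral is homogeneous of degree mn in K. Among bodies with the same h(v) it is monotone under
inclusion, since enlarging the body enlarges the face cone, the radial function and all sections.

Take the largest dilate cP inside P'. It touches some facet of P', with normal v say, and comparing
masses there gives c^(mn-p) ≤ 1, because P and P' have the same mass at v and it is positive and
finite. If p > mn, this forces c ≥ 1, so P ⊆ P'; exchanging the roles of P and P' gives equality.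

If p = mn, then cP has the same masses as P' as well. Equality in the monotonicity puts the whole
touched facet of P' inside cP (`faceCone_subset_of_curvatureMeasure_eq`). Then cP also touches every
facet meeting that one, and contact spreads over the boundary. Formally, the set where the two
gauges agree is open and closed in ℝⁿ minus the origin, which is connected for n ≥ 2. -/

/-- A compact convex set containing the origin in its interior. -/
structure IsBody (K : Set (E n)) : Prop where
  convex : Convex ℝ K
  isCompact : IsCompact K
  zero_mem : 0 ∈ interior K

theorem IsPolytope.isBody {P : Set (E n)} (hP : IsPolytope P) (h₀ : 0 ∈ interior P) :
    IsBody P := by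
  obtain ⟨⟨s, hs, rfl⟩, -⟩ := hP
  exact ⟨convex_convexHull ℝ s, hs.isCompact_convexHull ℝ, h₀⟩

/-- The support function `h_K(v) = max {v ⬝ y : y ∈ K}`. -/
noncomputable def support (K : Set (E n)) (v : E n) : ℝ := sSup ((fun y => inner ℝ v y) '' K)

/-- The cone over the face of `K` with outer normal `v`. -/
def faceCone (K : Set (E n)) (v : E n) : Set (E n) :=
  {x | gauge K x * support K v ≤ inner ℝ v x}

theorem mem_faceCone {K : Set (E n)} {v x : E n} :
    x ∈ faceCone K v ↔ gauge K x * support K v ≤ inner ℝ v x := Iff.rfl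

theorem zero_mem_faceCone (K : Set (E n)) (v : E n) : 0 ∈ faceCone K v := by
  simp [mem_faceCone]

theorem smul_mem_faceCone {K : Set (E n)} {v x : E n} (hx : x ∈ faceCone K v) {t : ℝ}
    (ht : 0 ≤ t) : t • x ∈ faceCone K v := by
  rw [mem_faceCone, gauge_smul_of_nonneg ht, inner_smul_right, smul_eq_mul, mul_assoc]
  exact mul_le_mul_of_nonneg_left hx ht

namespace IsBody

variable {K : Set (E n)} (hK : IsBody K)
include hK

theorem mem_nhds : K ∈ 𝓝 (0 : E n) := mem_interior_iff_mem_nhds.1 hK.zero_mem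

theorem gauge_le_one_iff {x : E n} : gauge K x ≤ 1 ↔ x ∈ K := by
  rw [gauge_le_one_iff_mem_closure hK.convex hK.mem_nhds, hK.isCompact.isClosed.closure_eq]

theorem gauge_pos {x : E n} (hx : x ≠ 0) : 0 < gauge K x :=
  (_root_.gauge_pos (absorbent_nhds_zero hK.mem_nhds)
    ((NormedSpace.isVonNBounded_iff ℝ).2 hK.isCompact.isBounded)).2 hx

theorem continuous_gauge : Continuous (gauge K) :=
  _root_.continuous_gauge hK.convex hK.mem_nhds

theorem smul_mem {x : E n} : (gauge K x)⁻¹ • x ∈ K := by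
  rw [← hK.gauge_le_one_iff, gauge_smul_of_nonneg (inv_nonneg.2 (gauge_nonneg x)), smul_eq_mul]
  exact inv_mul_le_one

theorem radial_eq {x : E n} (hx : x ≠ 0) : radial K x = (gauge K x)⁻¹ := by
  have hg := hK.gauge_pos hx
  refine IsGreatest.csSup_eq ⟨⟨inv_nonneg.2 hg.le, hK.smul_mem⟩, ?_⟩
  rintro t ⟨ht, htx⟩
  rw [← hK.gauge_le_one_iff, gauge_smul_of_nonneg ht, smul_eq_mul] at htx
  rwa [← one_div, le_div_iff₀ hg]

theorem radial_pos {x : E n} (hx : x ≠ 0) : 0 < radial K x := by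
  rw [hK.radial_eq hx]
  exact inv_pos.2 (hK.gauge_pos hx)

theorem radial_smul_mem_frontier {x : E n} (hx : x ≠ 0) : radial K x • x ∈ frontier K := by
  rw [← gauge_eq_one_iff_mem_frontier hK.convex hK.mem_nhds,
    gauge_smul_of_nonneg (hK.radial_pos hx).le, hK.radial_eq hx, smul_eq_mul,
    inv_mul_cancel₀ (hK.gauge_pos hx).ne']

theorem isGreatest_support (v : E n) : IsGreatest ((fun y => inner ℝ v y) '' K) (support K v) :=
  (hK.isCompact.image (by fun_prop)).isGreatest_sSup
    (Set.Nonempty.image _ ⟨0, interior_subset hK.zero_mem⟩)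

theorem inner_le_support (v : E n) {y : E n} (hy : y ∈ K) : inner ℝ v y ≤ support K v :=
  (hK.isGreatest_support v).2 ⟨y, hy, rfl⟩

theorem support_le {v : E n} {a : ℝ} (h : ∀ y ∈ K, inner ℝ v y ≤ a) : support K v ≤ a := by
  obtain ⟨y, hy, hyv⟩ := (hK.isGreatest_support v).1
  exact hyv.symm.trans_le (h y hy)

theorem inner_le (v x : E n) : inner ℝ v x ≤ gauge K x * support K v := by
  rcases eq_or_ne x 0 with rfl | hx
  · simp
  have h := hK.inner_le_support v (hK.smul_mem (x := x))
  rwa [inner_smul_right, inv_mul_le_iff₀ (hK.gauge_pos hx)] at h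

theorem support_pos {v : E n} (hv : v ≠ 0) : 0 < support K v := by
  have h := hK.inner_le v v
  have h1 : 0 < inner ℝ v v := real_inner_self_pos.2 hv
  exact pos_of_mul_pos_right (h1.trans_le h) (gauge_nonneg v)

/-- The reverse inequality is `inner_le`. The one-sided form of the definition is the convenient one
for convexity and for comparing bodies. -/
theorem mem_faceCone_iff {v x : E n} :
    x ∈ faceCone K v ↔ gauge K x * support K v = inner ℝ v x :=
  ⟨fun h => le_antisymm h (hK.inner_le v x), fun h => h.le⟩

theorem isClosed_faceCone (v : E n) : IsClosed (faceCone K v) :=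
  isClosed_le (hK.continuous_gauge.mul continuous_const) (by fun_prop)

theorem convex_faceCone {v : E n} (hv : v ≠ 0) : Convex ℝ (faceCone K v) := by
  intro x hx y hy a b ha hb _
  have hx' := smul_mem_faceCone hx ha
  have hy' := smul_mem_faceCone hy hb
  rw [mem_faceCone] at hx' hy' ⊢
  have h := mul_le_mul_of_nonneg_right (gauge_add_le hK.convex (absorbent_nhds_zero hK.mem_nhds)
    (a • x) (b • y)) (hK.support_pos hv).le
  rw [inner_add_right]
  linarith

theorem mem_gaussImage_radial_iff (u v : S n) :
    v ∈ gaussImage K (radial K (u : E n) • (u : E n)) ↔ (u : E n) ∈ faceCone K v := by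
  have hu : (u : E n) ≠ 0 := ne_zero_of_mem_unit_sphere u
  have hg := hK.gauge_pos hu
  have hr : gauge K (u : E n) * radial K (u : E n) = 1 := by
    rw [hK.radial_eq hu, mul_inv_cancel₀ hg.ne']
  change (∀ y ∈ K, inner ℝ (v : E n) (y - radial K (u : E n) • (u : E n)) ≤ 0) ↔
    gauge K (u : E n) * support K v ≤ inner ℝ (v : E n) (u : E n)
  simp only [inner_sub_right, inner_smul_right, sub_nonpos]
  constructor
  · intro h
    have := mul_le_mul_of_nonneg_left (hK.support_le h) hg.le
    rwa [← mul_assoc, hr, one_mul] at this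
  · intro h y hy
    refine (hK.inner_le_support v hy).trans ?_
    have := mul_le_mul_of_nonneg_left h (hK.radial_pos hu).le
    rwa [← mul_assoc, mul_comm (radial K (u : E n)), hr, one_mul] at this

theorem reverseRadialGaussImage_singleton (v : S n) :
    reverseRadialGaussImage K {v} = {u : S n | (u : E n) ∈ faceCone K v} := by
  ext u
  rw [Set.mem_ofPred_eq, ← hK.mem_gaussImage_radial_iff]
  have hf := hK.radial_smul_mem_frontier (ne_zero_of_mem_unit_sphere u)
  simp [reverseRadialGaussImage, reverseGaussImage, hf]

/-- The functionals w / h(w) and v / h(v) are both at most the gauge, and the second equals it on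
the face cone of v. Their difference is nonpositive on that cone and vanishes at an interior point,
so it is zero. -/
theorem eq_of_mem_interior_faceCone {x v w : E n} (hv : ‖v‖ = 1) (hw : ‖w‖ = 1)
    (hxv : x ∈ interior (faceCone K v)) (hxw : x ∈ faceCone K w) : w = v := by
  have hv0 : v ≠ 0 := norm_ne_zero_iff.1 (by simp [hv])
  have hw0 : w ≠ 0 := norm_ne_zero_iff.1 (by simp [hw])
  have hsv := hK.support_pos hv0
  have hsw := hK.support_pos hw0
  set z : E n := (support K w)⁻¹ • w - (support K v)⁻¹ • v with hz
  have key : ∀ y, y ∈ faceCone K v → inner ℝ z y ≤ 0 := by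
    intro y hy
    have h1 := hK.inner_le w y
    have h2 := hK.mem_faceCone_iff.1 hy
    rw [hz, inner_sub_left, real_inner_smul_left, real_inner_smul_left, ← h2, sub_nonpos,
      inv_mul_le_iff₀ hsw]
    field_simp
    linarith
  have hx0 : inner ℝ z x = 0 := by
    have h1 := hK.mem_faceCone_iff.1 hxw
    have h2 := hK.mem_faceCone_iff.1 (interior_subset hxv)
    rw [hz, inner_sub_left, real_inner_smul_left, real_inner_smul_left, ← h2, ← h1]
    field_simp
    simp
  have hz0 : z = 0 := by
    -- A small move from x in the direction z stays in the cone, yet would make the functional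
    -- positive unless z = 0.
    have hcont : Continuous fun t : ℝ => x + t • z := by fun_prop
    have hev : ∀ᶠ t in 𝓝 (0 : ℝ), x + t • z ∈ interior (faceCone K v) :=
      hcont.continuousAt.eventually_mem (by simpa using isOpen_interior.mem_nhds hxv)
    obtain ⟨ε, hε, hball⟩ := Metric.eventually_nhds_iff.1 hev
    have h := key _ (interior_subset (@hball (ε / 2) (by
      rw [Real.dist_eq, sub_zero, abs_of_pos (half_pos hε)]; exact half_lt_self hε)))
    rw [inner_add_right, hx0, inner_smul_right, zero_add] at h
    by_contra hne
    have := mul_pos (half_pos hε) (real_inner_self_pos.2 hne)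
    linarith
  have hwv : (support K w)⁻¹ • w = (support K v)⁻¹ • v := sub_eq_zero.1 hz0
  have hn := congrArg norm hwv
  rw [norm_smul, norm_smul, hv, hw, mul_one, mul_one, Real.norm_of_nonneg (inv_pos.2 hsw).le,
    Real.norm_of_nonneg (inv_pos.2 hsv).le] at hn
  rw [hn] at hwv
  exact smul_right_injective _ (inv_pos.2 hsv).ne' hwv

theorem outerNormal_eq {u v : S n} (hu : (u : E n) ∈ interior (faceCone K v)) :
    outerNormal K (radial K (u : E n) • (u : E n)) = v := by
  have hne : (gaussImage K (radial K (u : E n) • (u : E n))).Nonempty :=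
    ⟨v, (hK.mem_gaussImage_radial_iff u v).2 (interior_subset hu)⟩
  rw [outerNormal, dif_pos hne]
  exact hK.eq_of_mem_interior_faceCone (by simp) (by simp) hu
    ((hK.mem_gaussImage_radial_iff u _).1 hne.some_mem)

theorem exists_mem_faceCone (x : E n) (hx : x ≠ 0) : ∃ v : S n, x ∈ faceCone K v := by
  have hg := hK.gauge_pos hx
  have hz : (gauge K x)⁻¹ • x ∉ interior K := by
    rw [← gauge_lt_one_iff_mem_interior hK.convex hK.mem_nhds,
      gauge_smul_of_nonneg (inv_nonneg.2 hg.le), smul_eq_mul, inv_mul_cancel₀ hg.ne']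
    exact lt_irrefl _
  obtain ⟨f, hf⟩ := geometric_hahn_banach_open_point hK.convex.interior isOpen_interior hz
  set w := (InnerProductSpace.toDual ℝ (E n)).symm f with hw
  have hfw : ∀ y, f y = inner ℝ w y := fun y => by
    rw [hw, InnerProductSpace.toDual_symm_apply]
  have hw0 : w ≠ 0 := by
    intro h0
    have := hf 0 hK.zero_mem
    simp [hfw, h0] at this
  have hsup : ∀ y ∈ K, inner ℝ w y ≤ inner ℝ w ((gauge K x)⁻¹ • x) := by
    intro y hy
    have hy' : y ∈ closure (interior K) := by
      rw [hK.convex.closure_interior_eq_closure_of_nonempty_interior ⟨0, hK.zero_mem⟩]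
      exact subset_closure hy
    refine le_on_closure (f := fun y => inner ℝ w y) (fun y hy => ?_) (by fun_prop)
      continuousOn_const hy'
    rw [← hfw, ← hfw]
    exact (hf y hy).le
  have hn : 0 < ‖w‖ := norm_pos_iff.2 hw0
  refine ⟨⟨‖w‖⁻¹ • w, by simp [norm_smul, hn.ne']⟩, ?_⟩
  change gauge K x * support K (‖w‖⁻¹ • w) ≤ inner ℝ (‖w‖⁻¹ • w) x
  rw [← le_div_iff₀' hg]
  refine hK.support_le fun y hy => ?_
  have h := hsup y hy
  rw [inner_smul_right] at h
  rw [real_inner_smul_left, real_inner_smul_left, mul_div_assoc]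
  refine mul_le_mul_of_nonneg_left (h.trans_eq ?_) (inv_nonneg.2 hn.le)
  rw [div_eq_inv_mul]

/-! ### Behaviour under dilation and inclusion -/

theorem smul {c : ℝ} (hc : 0 < c) : IsBody (c • K) :=
  ⟨hK.convex.smul c, hK.isCompact.smul c, by
    rw [interior_smul₀ hc.ne']
    exact ⟨0, hK.zero_mem, smul_zero c⟩⟩

theorem support_smul {c : ℝ} (hc : 0 ≤ c) (v : E n) : support (c • K) v = c * support K v := by
  refine IsGreatest.csSup_eq ?_
  obtain ⟨⟨y, hy, hyv⟩, h⟩ := hK.isGreatest_support v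
  refine ⟨⟨c • y, smul_mem_smul_set hy, ?_⟩, ?_⟩
  · simp only [← hyv, inner_smul_right]
  · rintro _ ⟨_, ⟨z, hz, rfl⟩, rfl⟩
    simp only [inner_smul_right]
    exact mul_le_mul_of_nonneg_left (h ⟨z, hz, rfl⟩) hc

theorem faceCone_smul {c : ℝ} (hc : 0 < c) (v : E n) : faceCone (c • K) v = faceCone K v := by
  ext x
  change gauge (c • K) x * support (c • K) v ≤ _ ↔ gauge K x * support K v ≤ _
  rw [gauge_smul_left_of_nonneg hc.le, hK.support_smul hc.le, Pi.smul_apply, smul_eq_mul]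
  field_simp

theorem radial_smul {c : ℝ} (hc : 0 < c) {x : E n} (hx : x ≠ 0) :
    radial (c • K) x = c * radial K x := by
  rw [(hK.smul hc).radial_eq hx, hK.radial_eq hx, gauge_smul_left_of_nonneg hc.le, Pi.smul_apply,
    smul_eq_mul, mul_inv, inv_inv]

theorem radial_mono {K' : Set (E n)} (hK' : IsBody K') (h : K ⊆ K') {x : E n} (hx : x ≠ 0) :
    radial K x ≤ radial K' x := by
  rw [hK.radial_eq hx, hK'.radial_eq hx]
  exact inv_anti₀ (hK'.gauge_pos hx) (gauge_mono (absorbent_nhds_zero hK.mem_nhds) h x)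

theorem faceCone_subset_of_subset {K' : Set (E n)} (hK' : IsBody K') (h : K ⊆ K') {v : E n}
    (hv : support K v = support K' v) (hv0 : v ≠ 0) : faceCone K v ⊆ faceCone K' v := by
  intro x hx
  refine mem_faceCone.2 (le_trans ?_ hx)
  rw [hv]
  exact mul_le_mul_of_nonneg_right (gauge_mono (absorbent_nhds_zero hK.mem_nhds) h x)
    (hK'.support_pos hv0).le

theorem gauge_eq_of_mem_faceCone {K' : Set (E n)} (hK' : IsBody K') {v x : E n}
    (hv : support K v = support K' v) (hv0 : v ≠ 0) (hx : x ∈ faceCone K v)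
    (hx' : x ∈ faceCone K' v) : gauge K x = gauge K' x := by
  have h := (hK.mem_faceCone_iff.1 hx).trans (hK'.mem_faceCone_iff.1 hx').symm
  rw [hv] at h
  exact mul_right_cancel₀ (hK'.support_pos hv0).ne' h

end IsBody

/-- Finitely many unit normals, each with a face cone of nonempty interior, whose face cones
cover the space. -/
theorem IsPolytope.exists_finite_faceCone {P : Set (E n)} (hP : IsPolytope P)
    (h₀ : 0 ∈ interior P) (hn : 0 < n) :
    ∃ V : Set (S n), V.Finite ∧ (∀ v ∈ V, (interior (faceCone P v)).Nonempty) ∧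
      ∀ x : E n, ∃ v ∈ V, x ∈ faceCone P v := by
  classical
  have hB := hP.isBody h₀
  obtain ⟨⟨s, hs, hPs⟩, -⟩ := hP
  -- The generating points at which v attains the support number. The face cone depends only on this
  -- subset of s, so there are finitely many face cones.
  let act : S n → Set (E n) := fun v => {y ∈ s | inner ℝ (v : E n) y = support P v}
  have hact : ∀ v w : S n, act v = act w → faceCone P v ⊆ faceCone P w := by
    intro v w hvw x hx
    rcases eq_or_ne x 0 with rfl | hx0
    · exact zero_mem_faceCone P w
    have hg := hB.gauge_pos hx0
    have hmem := hB.smul_mem (x := x)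
    lift s to Finset (E n) using hs
    rw [hPs, Finset.mem_convexHull', ← hPs] at hmem
    obtain ⟨a, ha, ha1, hax⟩ := hmem
    have hsP : ∀ y ∈ s, y ∈ P := fun y hy => hPs ▸ subset_convexHull ℝ _ hy
    have hval : ∀ w : S n, inner ℝ (w : E n) ((gauge P x)⁻¹ • x) =
        ∑ y ∈ s, a y * inner ℝ (w : E n) y := fun w => by
      rw [← hax, inner_sum]
      simp [inner_smul_right]
    -- With x / gauge(x) a convex combination of points of s, x lies in the face cone of w exactly
    -- when every point of positive weight is active for w.
    have hsupp : ∀ w : S n, x ∈ faceCone P w ↔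
        ∑ y ∈ s, a y * inner ℝ (w : E n) y = ∑ y ∈ s, a y * support P w := by
      intro w
      rw [← hval, ← Finset.sum_mul, ha1, one_mul, hB.mem_faceCone_iff, inner_smul_right,
        inv_mul_eq_iff_eq_mul₀ hg.ne', eq_comm]
    rw [hsupp] at hx ⊢
    have h1 := (Finset.sum_eq_sum_iff_of_le fun y hy =>
      mul_le_mul_of_nonneg_left (hB.inner_le_support (v : E n) (hsP y hy)) (ha y hy)).1 hx
    refine Finset.sum_congr rfl fun y hy => ?_
    rcases eq_or_ne (a y) 0 with h0 | h0
    · simp [h0]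
    · have : y ∈ act v := ⟨hy, mul_left_cancel₀ h0 (h1 y hy)⟩
      rw [hvw] at this
      rw [this.2]
  have hfin : (Set.range act).Finite :=
    hs.finite_subsets.subset (by rintro _ ⟨v, rfl⟩; exact fun y hy => hy.1)
  have : Nonempty (S n) := by
    have : Nonempty (Fin n) := ⟨⟨0, hn⟩⟩
    exact (NormedSpace.sphere_nonempty.2 zero_le_one).to_subtype
  let pick := Function.invFun act
  have hpick : ∀ v, act (pick (act v)) = act v := fun v => Function.invFun_eq ⟨v, rfl⟩
  set W : Set (S n) := pick '' Set.range act with hW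
  have hWfin : W.Finite := hfin.image _
  have hcov : ∀ x : E n, ∃ v ∈ W, x ∈ faceCone P v := by
    intro x
    obtain ⟨v, hv⟩ : ∃ v : S n, x ∈ faceCone P v := by
      rcases eq_or_ne x 0 with rfl | hx
      · exact ⟨Classical.arbitrary _, zero_mem_faceCone P _⟩
      · exact hB.exists_mem_faceCone x hx
    exact ⟨_, ⟨_, ⟨v, rfl⟩, rfl⟩, hact v _ (hpick v).symm hv⟩
  refine ⟨{v ∈ W | (interior (faceCone P v)).Nonempty}, hWfin.subset fun v h => h.1,
    fun v h => h.2, ?_⟩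
  set C := ⋃ v ∈ {v ∈ W | (interior (faceCone P v)).Nonempty}, faceCone P (v : E n) with hC
  set D := ⋃ v ∈ {v ∈ W | ¬ (interior (faceCone P v)).Nonempty}, faceCone P (v : E n) with hD
  have hCc : IsClosed C := (hWfin.subset fun v h => h.1).isClosed_biUnion
    fun v _ => hB.isClosed_faceCone v
  -- A closed convex set without interior is its own frontier, hence null; so is a finite union of
  -- such sets. The open complement of C lies in D and must therefore be empty.
  have hDi : interior D = ∅ := by
    refine (isOpen_interior.measure_eq_zero_iff volume).1
      (measure_mono_null interior_subset ?_)
    refine (measure_biUnion_null_iff (hWfin.subset fun v h => h.1).countable).2 fun v hv => ?_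
    have h := (hB.convex_faceCone (ne_zero_of_mem_unit_sphere v)).addHaar_frontier volume
    rwa [(hB.isClosed_faceCone v).frontier_eq, Set.not_nonempty_iff_eq_empty.1 hv.2,
      sdiff_empty] at h
  have hCD : Cᶜ ⊆ D := by
    intro x hx
    obtain ⟨v, hv, hxv⟩ := hcov x
    by_cases hvi : (interior (faceCone P v)).Nonempty
    · refine absurd ?_ hx
      rw [hC, mem_iUnion₂]
      exact ⟨v, ⟨hv, hvi⟩, hxv⟩
    · rw [hD, mem_iUnion₂]
      exact ⟨v, ⟨hv, hvi⟩, hxv⟩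
  have hCu : C = univ := by
    have : Cᶜ ⊆ interior D := interior_maximal hCD hCc.isOpen_compl
    rw [hDi] at this
    exact Set.compl_empty_iff.1 (Set.subset_empty_iff.1 this)
  intro x
  have hx : x ∈ C := hCu ▸ mem_univ x
  simpa only [hC, mem_iUnion, exists_prop] using hx

end Body

end ADQ

namespace ADQ

/-! ### The curvature measure at a single normal -/

section Curvature

open Set Topology

variable {n m : ℕ}

/-! ### Monotonicity and scaling of sections and of the dual Radon transform -/

theorem finrank_spanWith (hm : 1 ≤ m) (u : S n)
    (ζ : Grassmannian (ℝ ∙ (u : E n))ᗮ (m - 1)) :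
    Module.finrank ℝ (spanWith (u : E n) ζ.1) = m := by
  have hd : (ℝ ∙ (u : E n)) ⊓ ζ.1.map (ℝ ∙ (u : E n))ᗮ.subtype = ⊥ :=
    eq_bot_iff.2 (le_trans (inf_le_inf_left _ (Submodule.map_subtype_le _ _))
      (Submodule.inf_orthogonal_eq_bot _).le)
  have h := Submodule.finrank_sup_add_finrank_inf_eq (ℝ ∙ (u : E n))
    (ζ.1.map (ℝ ∙ (u : E n))ᗮ.subtype)
  rw [hd, finrank_bot, finrank_span_singleton (ne_zero_of_mem_unit_sphere u),
    Submodule.finrank_map_subtype_eq, ζ.2] at h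
  rw [spanWith]
  omega

/-- Monotonicity of the lower integral needs no measurability, so measurability of section volumes
in the subspace never has to be proved. -/
theorem dualRadon_mono (hm : 1 ≤ m) {F G : Submodule ℝ (E n) → ℝ≥0∞}
    (h : ∀ ξ : Submodule ℝ (E n), Module.finrank ℝ ξ = m → F ξ ≤ G ξ) (u : S n) :
    dualRadon m F u ≤ dualRadon m G u :=
  mul_le_mul_right (lintegral_mono fun ζ => h _ (finrank_spanWith hm u ζ)) _

theorem dualRadon_const_mul {c : ℝ≥0∞} (hc : c ≠ ⊤) (F : Submodule ℝ (E n) → ℝ≥0∞) (u : S n) :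
    dualRadon m (fun ξ => c * F ξ) u = c * dualRadon m F u := by
  rw [dualRadon, dualRadon, lintegral_const_mul' _ _ hc, mul_left_comm]

theorem dualRadon_const (hm : m ≤ n) (c : ℝ≥0∞) (u : S n) :
    dualRadon m (fun _ => c) u = (m * ballVolume m) / (n * ballVolume n) * c := by
  have h : m - 1 ≤ Module.finrank ℝ (ℝ ∙ (u : E n))ᗮ := by
    have := Submodule.finrank_add_finrank_orthogonal (ℝ ∙ (u : E n))
    rw [finrank_span_singleton (ne_zero_of_mem_unit_sphere u), finrank_euclideanSpace_fin] at this
    omega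
  have := grassmannianHaar_isProbabilityMeasure (ℝ ∙ (u : E n))ᗮ h
  rw [dualRadon, lintegral_const, measure_univ, mul_one]

theorem sectionVolume_mono {K K' : Set (E n)} (h : K ⊆ K') (ξ : Submodule ℝ (E n)) :
    sectionVolume K ξ ≤ sectionVolume K' ξ :=
  measure_mono fun _ hx => h hx

theorem sectionVolume_smul {c : ℝ} (hc : 0 < c) (K : Set (E n)) {ξ : Submodule ℝ (E n)}
    (hξ : Module.finrank ℝ ξ = m) :
    sectionVolume (c • K) ξ = ENNReal.ofReal (c ^ m) * sectionVolume K ξ := by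
  have h : {x : ξ | (x : E n) ∈ c • K} = c • {x : ξ | (x : E n) ∈ K} := by
    ext x
    simp [mem_smul_set_iff_inv_smul_mem₀ hc.ne']
  rw [sectionVolume, h, Measure.addHaar_smul, hξ, abs_of_pos (pow_pos hc m), sectionVolume]

theorem sectionVolume_ball (hm : 1 ≤ m) (r : ℝ) {ξ : Submodule ℝ (E n)}
    (hξ : Module.finrank ℝ ξ = m) :
    sectionVolume (Metric.ball 0 r) ξ = volume (Metric.ball (0 : E m) r) := by
  have : Nontrivial ξ := Module.nontrivial_of_finrank_pos (R := ℝ) (by omega)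
  have : Nonempty (Fin m) := ⟨⟨0, hm⟩⟩
  have h : {x : ξ | (x : E n) ∈ Metric.ball 0 r} = Metric.ball 0 r := by
    ext x
    simp
  rw [sectionVolume, h, InnerProductSpace.volume_ball, hξ, EuclideanSpace.volume_ball,
    Fintype.card_fin]

/-- On a face cone, the density of the curvature measure up to a constant factor. -/
noncomputable def faceDensity (m : ℕ) (K : Set (E n)) (u : S n) : ℝ≥0∞ :=
  ENNReal.ofReal (radial K (u : E n) ^ m) *
    dualRadon m (fun ξ => sectionVolume K ξ ^ (n - 1)) u

/-- The integral of `faceDensity` over the directions of a face cone. -/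
noncomputable def faceMass (m : ℕ) (K : Set (E n)) (v : E n) : ℝ≥0∞ :=
  ∫⁻ u in {u : S n | (u : E n) ∈ faceCone K v}, faceDensity m K u ∂(sphereMeasure n)

/-- The spherical measure of a set of directions is n times the volume of the cone sector it spans
inside the unit ball, and that sector lies in T. -/
theorem sphereMeasure_eq_zero_of_cone {T : Set (E n)} (hT : MeasurableSet T)
    (h0 : volume T = 0) (hsmul : ∀ t : ℝ, 0 < t → ∀ x ∈ T, t • x ∈ T) :
    sphereMeasure n {u : S n | (u : E n) ∈ T} = 0 := by
  change (volume : Measure (E n)).toSphere (Subtype.val ⁻¹' T) = 0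
  rw [Measure.toSphere_apply' _ (measurable_subtype_coe hT)]
  refine mul_eq_zero_of_right _ (measure_mono_null ?_ h0)
  rintro _ ⟨t, ht, _, ⟨u, hu, rfl⟩, rfl⟩
  exact hsmul t ht.1 _ hu

instance : IsFiniteMeasure (sphereMeasure n) :=
  inferInstanceAs (IsFiniteMeasure (volume : Measure (E n)).toSphere)

instance : (sphereMeasure n).IsOpenPosMeasure :=
  inferInstanceAs ((volume : Measure (E n)).toSphere.IsOpenPosMeasure)

theorem smul_faceCone (K : Set (E n)) (v : E n) {t : ℝ} (ht : 0 < t) :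
    t • faceCone K v = faceCone K v := by
  ext x
  rw [mem_smul_set_iff_inv_smul_mem₀ ht.ne']
  refine ⟨fun h => ?_, fun h => smul_mem_faceCone h (inv_pos.2 ht).le⟩
  simpa [ht.ne'] using smul_mem_faceCone h ht.le

theorem smul_mem_interior_faceCone {K : Set (E n)} {v x : E n}
    (hx : x ∈ interior (faceCone K v)) {t : ℝ} (ht : 0 < t) :
    t • x ∈ interior (faceCone K v) := by
  rw [← smul_faceCone K v ht, interior_smul₀ ht.ne']
  exact smul_mem_smul_set hx

namespace IsBody

variable {K : Set (E n)} (hK : IsBody K)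
include hK

theorem measurableSet_faceCone_directions (v : E n) :
    MeasurableSet {u : S n | (u : E n) ∈ faceCone K v} :=
  measurable_subtype_coe (hK.isClosed_faceCone v).measurableSet

theorem sphereMeasure_faceCone_diff_interior {v : E n} (hv : v ≠ 0) :
    sphereMeasure n {u : S n | (u : E n) ∈ faceCone K v \ interior (faceCone K v)} = 0 := by
  have hf := (hK.isClosed_faceCone v).frontier_eq
  refine sphereMeasure_eq_zero_of_cone
    ((hK.isClosed_faceCone v).measurableSet.diff isOpen_interior.measurableSet)
    (hf ▸ (hK.convex_faceCone hv).addHaar_frontier volume) fun t ht x hx => ?_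
  refine ⟨smul_mem_faceCone hx.1 ht.le, fun h => hx.2 ?_⟩
  simpa [ht.ne'] using smul_mem_interior_faceCone h (inv_pos.2 ht)

/-- Off a null set, directions of the face cone are interior to it, so the chosen normal is v
itself. Then u · v = gauge(u) h(v) and ρ = 1 / gauge, and the powers of the gauge with exponent p
cancel. -/
theorem curvatureMeasure_singleton (p : ℝ) (v : S n) :
    curvatureMeasure p m K {v} = ENNReal.ofReal (support K v ^ (-p)) * faceMass m K v := by
  have hv : (v : E n) ≠ 0 := ne_zero_of_mem_unit_sphere v
  rw [curvatureMeasure, hK.reverseRadialGaussImage_singleton, faceMass,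
    ← lintegral_const_mul' _ _ ENNReal.ofReal_ne_top]
  refine lintegral_congr_ae ((ae_restrict_iff' (hK.measurableSet_faceCone_directions v)).2 ?_)
  filter_upwards [measure_eq_zero_iff_ae_notMem.1 (hK.sphereMeasure_faceCone_diff_interior hv)]
    with u hu huv
  have hui : (u : E n) ∈ interior (faceCone K v) := by
    by_contra h
    exact hu ⟨huv, h⟩
  have hu0 : (u : E n) ≠ 0 := ne_zero_of_mem_unit_sphere u
  have hg := hK.gauge_pos hu0
  have hs := hK.support_pos hv
  rw [hK.outerNormal_eq hui, faceDensity, ← mul_assoc, ← ENNReal.ofReal_mul (by positivity),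
    real_inner_comm, ← hK.mem_faceCone_iff.1 huv, hK.radial_eq hu0, sub_eq_add_neg,
    Real.rpow_add (inv_pos.2 hg), Real.mul_rpow hg.le hs.le, Real.rpow_natCast,
    Real.inv_rpow hg.le (-p)]
  congr 2
  have := (Real.rpow_pos_of_pos hg (-p)).ne'
  field_simp

/-- Compare K with balls around the origin inside and outside it: their central sections have
constant volume, and the dual Radon transform of a constant is explicit. This makes face masses
finite, and zero only on null cones. -/
theorem exists_faceDensity_bounds (hm : 1 ≤ m) (hmn : m ≤ n) :
    ∃ a b : ℝ≥0∞, a ≠ 0 ∧ b ≠ ⊤ ∧ ∀ u : S n, a ≤ faceDensity m K u ∧ faceDensity m K u ≤ b := by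
  obtain ⟨r, hr, hrK⟩ := Metric.mem_nhds_iff.1 hK.mem_nhds
  obtain ⟨R, hR, hKR⟩ := hK.isCompact.isBounded.subset_ball_lt 0 (0 : E n)
  have hball : ∀ k : ℕ, ballVolume k ≠ 0 ∧ ballVolume k ≠ ⊤ := fun k =>
    ⟨(Metric.measure_ball_pos volume _ one_pos).ne', measure_ball_lt_top.ne⟩
  have hm0 : (m : ℝ≥0∞) ≠ 0 := by exact_mod_cast (by omega : m ≠ 0)
  have hn0 : (n : ℝ≥0∞) ≠ 0 := by exact_mod_cast (by omega : n ≠ 0)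
  set κ : ℝ≥0∞ := (m * ballVolume m) / (n * ballVolume n) with hκ
  have hκ0 : κ ≠ 0 := ENNReal.div_ne_zero.2
    ⟨mul_ne_zero hm0 (hball m).1, ENNReal.mul_ne_top (by simp) (hball n).2⟩
  have hκt : κ ≠ ⊤ := ENNReal.div_ne_top (ENNReal.mul_ne_top (by simp) (hball m).2)
    (mul_ne_zero hn0 (hball n).1)
  refine ⟨ENNReal.ofReal (r ^ m) * (κ * volume (Metric.ball (0 : E m) r) ^ (n - 1)),
    ENNReal.ofReal (R ^ m) * (κ * volume (Metric.ball (0 : E m) R) ^ (n - 1)), ?_, ?_, fun u => ?_⟩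
  · exact mul_ne_zero (ENNReal.ofReal_pos.2 (pow_pos hr m)).ne' (mul_ne_zero hκ0
      (pow_ne_zero _ (Metric.measure_ball_pos volume _ hr).ne'))
  · exact ENNReal.mul_ne_top ENNReal.ofReal_ne_top (ENNReal.mul_ne_top hκt
      (ENNReal.pow_ne_top measure_ball_lt_top.ne))
  have hu0 : (u : E n) ≠ 0 := ne_zero_of_mem_unit_sphere u
  have hu1 : ‖(u : E n)‖ = 1 := by simp
  have hg := hK.gauge_pos hu0
  have h1 : r * gauge K (u : E n) ≤ ‖(u : E n)‖ := mul_gauge_le_norm hrK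
  have h2 : ‖(u : E n)‖ / R ≤ gauge K (u : E n) :=
    le_gauge_of_subset_closedBall (absorbent_nhds_zero hK.mem_nhds) hR.le
      (hKR.trans Metric.ball_subset_closedBall)
  rw [hu1] at h1 h2
  rw [faceDensity, ← dualRadon_const hmn _ u, ← dualRadon_const hmn _ u, hK.radial_eq hu0]
  have h1' : r ≤ (gauge K (u : E n))⁻¹ := by rwa [← one_div, le_div_iff₀ hg]
  have h2' : (gauge K (u : E n))⁻¹ ≤ R := by
    rw [div_le_iff₀ hR] at h2
    rwa [inv_le_iff_one_le_mul₀' hg]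
  constructor
  · refine mul_le_mul' (ENNReal.ofReal_le_ofReal (pow_le_pow_left₀ hr.le h1' m))
      (dualRadon_mono hm (fun ξ hξ => ?_) u)
    rw [← sectionVolume_ball hm r hξ]
    exact pow_le_pow_left' (sectionVolume_mono hrK ξ) _
  · refine mul_le_mul' (ENNReal.ofReal_le_ofReal
      (pow_le_pow_left₀ (inv_pos.2 hg).le h2' m)) (dualRadon_mono hm (fun ξ hξ => ?_) u)
    rw [← sectionVolume_ball hm R hξ]
    exact pow_le_pow_left' (sectionVolume_mono hKR ξ) _

theorem faceMass_ne_top (hm : 1 ≤ m) (hmn : m ≤ n) (v : E n) : faceMass m K v ≠ ⊤ := by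
  obtain ⟨_, b, -, hb, h⟩ := hK.exists_faceDensity_bounds hm hmn
  refine ne_top_of_le_ne_top ?_ (lintegral_mono fun u => (h u).2)
  rw [lintegral_const]
  exact ENNReal.mul_ne_top hb (measure_ne_top _ _)

theorem faceMass_ne_zero_iff (hm : 1 ≤ m) (hmn : m ≤ n) {v : E n} (hv : v ≠ 0) :
    faceMass m K v ≠ 0 ↔ (interior (faceCone K v)).Nonempty := by
  have hT : MeasurableSet {u : S n | (u : E n) ∈ faceCone K v} :=
    hK.measurableSet_faceCone_directions v
  constructor
  · intro h
    by_contra he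
    rw [Set.not_nonempty_iff_eq_empty] at he
    have := hK.sphereMeasure_faceCone_diff_interior hv
    rw [he, sdiff_empty] at this
    exact h (setLIntegral_measure_zero _ _ this)
  · rintro ⟨x, hx⟩ h
    have : Nontrivial (E n) := ⟨v, 0, hv⟩
    -- A direction needs a nonzero point; {0} has empty interior in a nontrivial space.
    obtain ⟨y, hy, hy0⟩ : ∃ y ∈ interior (faceCone K v), y ≠ 0 := by
      by_contra! hall
      have hs : interior (faceCone K v) ⊆ {0} := fun y hy => hall y hy
      exact (Set.Nonempty.mono (interior_maximal hs isOpen_interior) ⟨x, hx⟩).ne_empty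
        (interior_singleton (0 : E n))
    have hpos : 0 < ‖y‖ := norm_pos_iff.2 hy0
    obtain ⟨a, _, ha, -, hab⟩ := hK.exists_faceDensity_bounds hm hmn
    have hle : a * sphereMeasure n {u : S n | (u : E n) ∈ faceCone K v} ≤ faceMass m K v := by
      rw [← setLIntegral_const]
      exact lintegral_mono fun u => (hab u).1
    rw [h, nonpos_iff_eq_zero, mul_eq_zero] at hle
    have h0 := hle.resolve_left ha
    have hopen : IsOpen {u : S n | (u : E n) ∈ interior (faceCone K v)} :=
      isOpen_interior.preimage continuous_subtype_val
    refine (hopen.measure_ne_zero (sphereMeasure n) ⟨⟨‖y‖⁻¹ • y, ?_⟩, ?_⟩)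
      (measure_mono_null (fun u hu => interior_subset (s := faceCone K v) hu) h0)
    · simp [norm_smul, hpos.ne']
    · exact smul_mem_interior_faceCone hy (inv_pos.2 hpos)

/-- The radial factor contributes degree m and the power n - 1 of an m-dimensional volume
contributes m(n - 1); the face cone does not change. -/
theorem faceMass_smul (hm : 1 ≤ m) (hn : 1 ≤ n) {c : ℝ} (hc : 0 < c) (v : E n) :
    faceMass m (c • K) v = ENNReal.ofReal (c ^ (m * n)) * faceMass m K v := by
  rw [faceMass, faceMass, hK.faceCone_smul hc, ← lintegral_const_mul' _ _ ENNReal.ofReal_ne_top]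
  congr 1
  funext u
  -- The scaling law holds only on m-dimensional subspaces, hence two applications of monotonicity
  -- rather than rewriting the integrand.
  have h : dualRadon m (fun ξ => sectionVolume (c • K) ξ ^ (n - 1)) u =
      dualRadon m (fun ξ => ENNReal.ofReal (c ^ m) ^ (n - 1) * sectionVolume K ξ ^ (n - 1)) u := by
    refine le_antisymm (dualRadon_mono hm (fun ξ hξ => ?_) u)
      (dualRadon_mono hm (fun ξ hξ => ?_) u) <;>
    rw [sectionVolume_smul hc K hξ, mul_pow]
  have hcm : 0 < c ^ m := pow_pos hc m
  rw [faceDensity, faceDensity, h,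
    dualRadon_const_mul (ENNReal.pow_ne_top ENNReal.ofReal_ne_top),
    hK.radial_smul hc (ne_zero_of_mem_unit_sphere u), mul_pow, ENNReal.ofReal_mul hcm.le,
    ← ENNReal.ofReal_pow hcm.le, ← mul_assoc, mul_right_comm (ENNReal.ofReal (c ^ m)),
    ← ENNReal.ofReal_mul hcm.le, mul_assoc, ← pow_succ', Nat.sub_add_cancel hn, ← pow_mul]

theorem curvatureMeasure_smul_singleton (p : ℝ) (hm : 1 ≤ m) (hn : 1 ≤ n) {c : ℝ} (hc : 0 < c)
    (v : S n) :
    curvatureMeasure p m (c • K) {v} =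
      ENNReal.ofReal (c ^ ((m : ℝ) * n - p)) * curvatureMeasure p m K {v} := by
  have hs := hK.support_pos (ne_zero_of_mem_unit_sphere v)
  rw [(hK.smul hc).curvatureMeasure_singleton, hK.curvatureMeasure_singleton,
    hK.faceMass_smul hm hn hc, hK.support_smul hc.le, ← mul_assoc, ← mul_assoc,
    ← ENNReal.ofReal_mul (by positivity), ← ENNReal.ofReal_mul (by positivity)]
  congr 2
  rw [Real.mul_rpow hc.le hs.le, sub_eq_add_neg, Real.rpow_add hc, ← Nat.cast_mul,
    Real.rpow_natCast]
  ring

theorem curvatureMeasure_singleton_ne_zero_iff (p : ℝ) (hm : 1 ≤ m) (hmn : m ≤ n) (v : S n) :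
    curvatureMeasure p m K {v} ≠ 0 ↔ (interior (faceCone K v)).Nonempty := by
  have hv : (v : E n) ≠ 0 := ne_zero_of_mem_unit_sphere v
  rw [← hK.faceMass_ne_zero_iff hm hmn hv, hK.curvatureMeasure_singleton, mul_ne_zero_iff]
  exact and_iff_right (ENNReal.ofReal_pos.2 (Real.rpow_pos_of_pos (hK.support_pos hv) _)).ne'

theorem curvatureMeasure_singleton_ne_top (p : ℝ) (hm : 1 ≤ m) (hmn : m ≤ n) (v : S n) :
    curvatureMeasure p m K {v} ≠ ⊤ := by
  rw [hK.curvatureMeasure_singleton]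
  exact ENNReal.mul_ne_top ENNReal.ofReal_ne_top (hK.faceMass_ne_top hm hmn v)

/-- If `K ⊆ K'` have the same support number at `v`, the face mass of `K'` at `v` exceeds that of
`K` by at least the integral over the new directions. -/
theorem faceMass_add_le {K' : Set (E n)} (hK' : IsBody K') (hm : 1 ≤ m) (h : K ⊆ K') {v : E n}
    (hv : support K v = support K' v) (hv0 : v ≠ 0) :
    faceMass m K v + ∫⁻ u in {u : S n | (u : E n) ∈ faceCone K' v} \
      {u : S n | (u : E n) ∈ faceCone K v}, faceDensity m K' u ∂(sphereMeasure n) ≤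
      faceMass m K' v := by
  have hsub : {u : S n | (u : E n) ∈ faceCone K v} ⊆ {u : S n | (u : E n) ∈ faceCone K' v} :=
    fun u hu => hK.faceCone_subset_of_subset hK' h hv hv0 hu
  rw [faceMass.eq_1 m K', ← lintegral_inter_add_sdiff (faceDensity m K')
    {u : S n | (u : E n) ∈ faceCone K' v} (hK.measurableSet_faceCone_directions v),
    inter_eq_right.2 hsub]
  refine add_le_add_left (lintegral_mono fun u => ?_) _
  have hu0 : (u : E n) ≠ 0 := ne_zero_of_mem_unit_sphere u
  exact mul_le_mul' (ENNReal.ofReal_le_ofReal (pow_le_pow_left₀ (hK.radial_pos hu0).le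
    (hK.radial_mono hK' h hu0) m)) (dualRadon_mono hm
      (fun ξ _ => pow_le_pow_left' (sectionVolume_mono h ξ) _) u)

theorem curvatureMeasure_singleton_le {K' : Set (E n)} (hK' : IsBody K') (p : ℝ) (hm : 1 ≤ m)
    (h : K ⊆ K') {v : S n} (hv : support K v = support K' v) :
    curvatureMeasure p m K {v} ≤ curvatureMeasure p m K' {v} := by
  rw [hK.curvatureMeasure_singleton, hK'.curvatureMeasure_singleton, hv]
  exact mul_le_mul_right (le_self_add.trans
    (hK.faceMass_add_le hK' hm h hv (ne_zero_of_mem_unit_sphere v))) _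

/-- If `K ⊆ K'` have the same support number and the same curvature at a facet normal `v` of
`K'`, then the facet of `K'` with normal `v` is contained in `K`. -/
theorem faceCone_subset_of_curvatureMeasure_eq {K' : Set (E n)} (hK' : IsBody K') (p : ℝ)
    (hm : 1 ≤ m) (hmn : m ≤ n) (h : K ⊆ K') {v : S n} (hv : support K v = support K' v)
    (hint : (interior (faceCone K' v)).Nonempty)
    (hC : curvatureMeasure p m K {v} = curvatureMeasure p m K' {v}) :
    faceCone K' v ⊆ faceCone K v := by
  have hv0 : (v : E n) ≠ 0 := ne_zero_of_mem_unit_sphere v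
  have hmass : faceMass m K v = faceMass m K' v := by
    rw [hK.curvatureMeasure_singleton, hK'.curvatureMeasure_singleton, hv] at hC
    exact (ENNReal.mul_right_inj (ENNReal.ofReal_pos.2
      (Real.rpow_pos_of_pos (hK'.support_pos hv0) _)).ne' ENNReal.ofReal_ne_top).1 hC
  have hadd := hK.faceMass_add_le hK' hm h hv hv0
  rw [← hmass] at hadd
  -- Finite equal masses leave nothing for the new directions; as the density is bounded below,
  -- these form a null set.
  have hint0 : ∫⁻ u in {u : S n | (u : E n) ∈ faceCone K' v} \
      {u : S n | (u : E n) ∈ faceCone K v}, faceDensity m K' u ∂(sphereMeasure n) = 0 := by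
    refine nonpos_iff_eq_zero.1 ((ENNReal.add_le_add_iff_left
      (hK.faceMass_ne_top hm hmn v)).1 ?_)
    rwa [add_zero]
  obtain ⟨a, _, ha, -, hab⟩ := hK'.exists_faceDensity_bounds hm hmn
  have hle := lintegral_mono (μ := (sphereMeasure n).restrict
    ({u : S n | (u : E n) ∈ faceCone K' v} \ {u : S n | (u : E n) ∈ faceCone K v}))
    fun u => (hab u).1
  rw [hint0, setLIntegral_const, nonpos_iff_eq_zero, mul_eq_zero] at hle
  have hnull := hle.resolve_left ha
  -- The open part of a null set of directions is empty. Taking the closure of the interior of the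
  -- cone then recovers the whole cone.
  have hopen : IsOpen {u : S n | (u : E n) ∈ interior (faceCone K' v) \ faceCone K v} :=
    (isOpen_interior.sdiff (hK.isClosed_faceCone v)).preimage continuous_subtype_val
  have hdir : {u : S n | (u : E n) ∈ interior (faceCone K' v) \ faceCone K v} ⊆
      {u : S n | (u : E n) ∈ faceCone K' v} \ {u : S n | (u : E n) ∈ faceCone K v} :=
    fun u hu => ⟨interior_subset (s := faceCone K' v) hu.1, hu.2⟩
  have hempty := (hopen.measure_eq_zero_iff (sphereMeasure n)).1 (measure_mono_null hdir hnull)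
  have hsub : interior (faceCone K' v) ⊆ faceCone K v := by
    intro x hx
    rcases eq_or_ne x 0 with rfl | hx0
    · exact zero_mem_faceCone K v
    have hpos : 0 < ‖x‖ := norm_pos_iff.2 hx0
    by_contra hxK
    have hmem : (⟨‖x‖⁻¹ • x, by simp [norm_smul, hpos.ne']⟩ : S n) ∈
        {u : S n | (u : E n) ∈ interior (faceCone K' v) \ faceCone K v} := by
      refine ⟨smul_mem_interior_faceCone hx (inv_pos.2 hpos), fun hxu => hxK ?_⟩
      simpa [hpos.ne'] using smul_mem_faceCone hxu hpos.le
    rw [hempty] at hmem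
    exact hmem
  refine subset_closure.trans ?_
  rw [← (hK'.convex_faceCone hv0).closure_interior_eq_closure_of_nonempty_interior hint]
  exact closure_minimal hsub (hK.isClosed_faceCone v)

end IsBody

end Curvature

end ADQ

namespace ADQ

/-! ### Comparison of polytopes with equal curvature measures -/

section Comparison

open Set Topology

variable {n m : ℕ} {P P' : Set (E n)}

/-- A largest dilate of a body `P` inside a polytope `P'` touches a facet of `P'`. -/
theorem IsPolytope.exists_smul_subset_support_eq (hP : IsBody P) (hP' : IsPolytope P')
    (hP'₀ : 0 ∈ interior P') (hn : 0 < n) :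
    ∃ c : ℝ, 0 < c ∧ c • P ⊆ P' ∧ ∃ v : S n, (interior (faceCone P' v)).Nonempty ∧
      support (c • P) v = support P' v := by
  have hB' := hP'.isBody hP'₀
  obtain ⟨V, hVfin, hVint, hVcov⟩ := hP'.exists_finite_faceCone hP'₀ hn
  have hVne : V.Nonempty := let ⟨v, hv, _⟩ := hVcov 0; ⟨v, hv⟩
  -- The optimal dilation factor is the least ratio of support numbers over the finitely many facet
  -- normals of P'; the minimizer w is the facet touched.
  obtain ⟨w, hw, hwmin⟩ := hVfin.exists_minimalFor
    (fun v : S n => support P' v / support P v) V hVne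
  have hpos : ∀ v : S n, 0 < support P v := fun v => hP.support_pos (ne_zero_of_mem_unit_sphere v)
  have hpos' : ∀ v : S n, 0 < support P' v :=
    fun v => hB'.support_pos (ne_zero_of_mem_unit_sphere v)
  have hc : 0 < support P' w / support P w := div_pos (hpos' w) (hpos w)
  refine ⟨_, hc, fun x hx => ?_, w, hVint w hw, ?_⟩
  · obtain ⟨v, hv, hxv⟩ := hVcov x
    have h1 := (hP.smul hc).inner_le_support v hx
    have hmin : support P' w / support P w ≤ support P' v / support P v :=
      (le_total _ _).elim id fun h => hwmin hv h
    rw [hP.support_smul hc.le] at h1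
    rw [← hB'.gauge_le_one_iff]
    have h2 := (le_div_iff₀ (hpos v)).1 hmin
    have h3 := (mem_faceCone.1 hxv).trans (h1.trans h2)
    exact le_of_mul_le_mul_right (by rwa [one_mul]) (hpos' v)
  · rw [hP.support_smul hc.le, div_mul_cancel₀ _ (hpos w).ne']

/-- At the facet touched by the largest dilate cP, monotonicity and homogeneity give c^(mn-p) ≤ 1.
The exponent is negative, so c ≥ 1. -/
theorem IsPolytope.subset_of_curvatureMeasure_eq (hP : IsBody P) (hP' : IsPolytope P')
    (hP'₀ : 0 ∈ interior P') (hm : 1 ≤ m) (hmn : m ≤ n) {p : ℝ} (hp : (m : ℝ) * n < p)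
    (hC : ∀ v : S n, curvatureMeasure p m P {v} = curvatureMeasure p m P' {v}) : P ⊆ P' := by
  have hn : 1 ≤ n := hm.trans hmn
  have hB' := hP'.isBody hP'₀
  obtain ⟨c, hc, hsub, v, hint, hv⟩ := hP'.exists_smul_subset_support_eq hP hP'₀ hn
  have hle := (hP.smul hc).curvatureMeasure_singleton_le hB' p hm hsub hv
  rw [hP.curvatureMeasure_smul_singleton p hm hn hc, ← hC] at hle
  have h0 : curvatureMeasure p m P {v} ≠ 0 := by
    rw [hC]
    exact (hB'.curvatureMeasure_singleton_ne_zero_iff p hm hmn v).2 hint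
  have hc1 : 1 ≤ c := by
    by_contra! hc1
    have h1 : ENNReal.ofReal (c ^ ((m : ℝ) * n - p)) ≤ 1 := by
      rw [← ENNReal.mul_le_mul_iff_left h0 (hP.curvatureMeasure_singleton_ne_top p hm hmn v),
        one_mul]
      exact hle
    rw [ENNReal.ofReal_le_one] at h1
    exact absurd (Real.one_lt_rpow_of_pos_of_lt_one_of_neg hc hc1 (sub_neg.2 hp)) h1.not_gt
  intro x hx
  rw [← hB'.gauge_le_one_iff]
  refine (gauge_mono (absorbent_nhds_zero (hP.smul hc).mem_nhds) hsub x).trans ?_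
  rw [gauge_smul_left_of_nonneg hc.le, Pi.smul_apply, smul_eq_mul]
  exact mul_le_one₀ (inv_le_one_of_one_le₀ hc1) (gauge_nonneg x) (hP.gauge_le_one_iff.2 hx)

/-- A body contained in a polytope with the same curvature measure and touching one of its facets
is equal to it. -/
theorem IsPolytope.eq_of_subset_of_curvatureMeasure_eq {Q : Set (E n)} (hQ : IsBody Q)
    (hP' : IsPolytope P') (hP'₀ : 0 ∈ interior P') (hm : 1 ≤ m) (hmn : m ≤ n) (hn : 2 ≤ n) (p : ℝ)
    (hsub : Q ⊆ P') (hC : ∀ v : S n, curvatureMeasure p m Q {v} = curvatureMeasure p m P' {v})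
    {w : S n} (hw : (interior (faceCone P' w)).Nonempty) (hsw : support Q w = support P' w) :
    Q = P' := by
  have hB' := hP'.isBody hP'₀
  obtain ⟨V, hVfin, hVint, hVcov⟩ := hP'.exists_finite_faceCone hP'₀ (by omega)
  have hmono : ∀ x, gauge P' x ≤ gauge Q x :=
    gauge_mono (absorbent_nhds_zero hQ.mem_nhds) hsub
  have hcontact : ∀ v : S n, (interior (faceCone P' v)).Nonempty → support Q v = support P' v →
      ∀ x ∈ faceCone P' v, gauge Q x = gauge P' x := fun v hint hv x hx =>
    hQ.gauge_eq_of_mem_faceCone hB' hv (ne_zero_of_mem_unit_sphere v)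
      (hQ.faceCone_subset_of_curvatureMeasure_eq hB' p hm hmn hsub hv hint (hC v) hx) hx
  have hclosed : IsClosed {x : E n | gauge Q x = gauge P' x} :=
    isClosed_eq hQ.continuous_gauge hB'.continuous_gauge
  have hopen : ∀ x : E n, x ≠ 0 → gauge Q x = gauge P' x →
      ∀ᶠ y in 𝓝 x, gauge Q y = gauge P' y := by
    intro x hx0 hx
    -- Finitely many closed cones: near x only those containing x occur.
    have hev : ∀ᶠ y in 𝓝 x, ∀ v ∈ V, y ∈ faceCone P' v → x ∈ faceCone P' v := by
      refine (Filter.eventually_all_finite hVfin).2 fun v _ => ?_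
      by_cases hxv : x ∈ faceCone P' v
      · exact Filter.Eventually.of_forall fun _ _ => hxv
      · filter_upwards [(hB'.isClosed_faceCone v).isOpen_compl.mem_nhds hxv] with y hy h
        exact absurd h hy
    filter_upwards [hev] with y hy
    obtain ⟨v, hv, hyv⟩ := hVcov y
    have hxv := hB'.mem_faceCone_iff.1 (hy v hv hyv)
    have hg := hQ.gauge_pos hx0
    -- The ray through x meets the boundaries of Q and P' at one point, which lies on the facet v of
    -- P'. So Q attains the support number of P' at v, and contact extends to the whole facet.
    refine hcontact v (hVint v hv) (le_antisymm ?_ ?_) y hyv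
    · exact hQ.support_le fun z hz => hB'.inner_le_support v (hsub hz)
    · refine le_of_mul_le_mul_left ?_ hg
      rw [hx, hxv, ← hx]
      exact hQ.inner_le v x
  have hall : ∀ x : E n, x ∈ ({0}ᶜ : Set (E n)) → gauge Q x = gauge P' x := by
    have hconn : IsPreconnected ({0}ᶜ : Set (E n)) :=
      (isConnected_compl_singleton_of_one_lt_rank (by
        rw [← Module.finrank_eq_rank, finrank_euclideanSpace_fin]
        exact_mod_cast hn) 0).isPreconnected
    have hx₀ : ∃ x ∈ ({0}ᶜ : Set (E n)), gauge Q x = gauge P' x := by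
      have : Nontrivial (E n) := ⟨w, 0, ne_zero_of_mem_unit_sphere w⟩
      by_contra! hne
      have hs : interior (faceCone P' w) ⊆ {0} := fun x hx => by
        by_contra hx0
        exact hne x hx0 (hcontact w hw hsw x (interior_subset hx))
      exact (hw.mono (interior_maximal hs isOpen_interior)).ne_empty
        (interior_singleton (0 : E n))
    obtain ⟨x₀, hx₀, hx₀'⟩ := hx₀
    -- The origin is removed from the agreement set because openness was shown only at nonzero
    -- points.
    refine hconn.subset_of_closure_inter_subset (u := {x | x ≠ 0 ∧ gauge Q x = gauge P' x})
      ?_ ⟨x₀, hx₀, hx₀, hx₀'⟩ ?_ |>.trans fun x hx => hx.2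
    · refine isOpen_iff_mem_nhds.2 fun x hx => ?_
      filter_upwards [isOpen_ne.mem_nhds hx.1, hopen x hx.1 hx.2] with y h1 h2
      exact ⟨h1, h2⟩
    · rintro x ⟨hx, hx0⟩
      exact ⟨hx0, closure_minimal (fun y hy => hy.2) hclosed hx⟩
  ext x
  rw [← hQ.gauge_le_one_iff, ← hB'.gauge_le_one_iff]
  rcases eq_or_ne x 0 with rfl | hx
  · simp
  · rw [hall x hx]

end Comparison

end ADQ

theorem mainTheorem4 (n m : ℕ) (hn : 2 ≤ n) (hm₁ : 1 ≤ m) (hm₂ : m ≤ n - 1) (p : ℝ)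
    (P P' : Set (ADQ.E n)) (hP : ADQ.IsPolytope P) (hP' : ADQ.IsPolytope P')
    (hP₀ : 0 ∈ interior P) (hP'₀ : 0 ∈ interior P')
    (hC : ∀ η : Set (ADQ.S n), MeasurableSet η →
      ADQ.curvatureMeasure p m P η = ADQ.curvatureMeasure p m P' η) :
    ((m : ℝ) * n < p → P = P') ∧
      (p = (m : ℝ) * n → ∃ c : ℝ, 0 < c ∧ P' = c • P) := by
  have hB := hP.isBody hP₀
  have hB' := hP'.isBody hP'₀
  have hmn : m ≤ n := hm₂.trans (Nat.sub_le n 1)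
  have hC' : ∀ v : ADQ.S n, ADQ.curvatureMeasure p m P {v} = ADQ.curvatureMeasure p m P' {v} :=
    fun v => hC {v} (measurableSet_singleton v)
  refine ⟨fun hp => ?_, fun hp => ?_⟩
  · exact (hP'.subset_of_curvatureMeasure_eq hB hP'₀ hm₁ hmn hp hC').antisymm
      (hP.subset_of_curvatureMeasure_eq hB' hP₀ hm₁ hmn hp fun v => (hC' v).symm)
  · obtain ⟨c, hc, hsub, v, hint, hv⟩ := hP'.exists_smul_subset_support_eq hB hP'₀ (by omega)
    refine ⟨c, hc, (hP'.eq_of_subset_of_curvatureMeasure_eq (hB.smul hc) hP'₀ hm₁ hmn hn p hsub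
      (fun w => ?_) hint hv).symm⟩
    -- For p = mn the scaling exponent vanishes, so the dilate has the same point masses as P.
    rw [hB.curvatureMeasure_smul_singleton p hm₁ (by omega) hc, hp, sub_self, Real.rpow_zero,
      ENNReal.ofReal_one, one_mul, ← hp]
    exact hC' w
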